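/- All topologies are assumed to be Hausdorff. For a topological group $G$, let $\mathrm{RUCB}(G)$ be the space of bounded functions $f:G\to\mathbb R$ that are right uniformly continuous, i.e. for every $\varepsilon>0$ there is a neighbourhood $V$ of the identity such that $xy^{-1}\in V$ implies $|f(x)-f(y)|<\varepsilon$. The group $G$ is called *amenable* if there is a positive linear functional $m$ on $\mathrm{RUCB}(G)$ with $m(1)=1$ and $m({}^{g}f)=m(f)$ for all $g\in G$ and $f\in\mathrm{RUCB}(G)$, where ${}^{g}f(x)=f(g^{-1}x)$. Let $C$ be a nonempty bounded convex subset of a topological vector space $X$. The group $G$ has the *approximate fixed point (AFP) property* on $C$ if for every continuous action of $G$ on $C$ by affine maps (the map $G\times C\to C$ being jointly continuous) there is a net $(x_i)$ in $C$ such that $x_i-g x_i\to 0$ for every $g\in G$. **Theorem.** For a locally compact group $G$ the following are equivalent: 1. $G$ is amenable; 2. $G$ has the AFP property on every nonempty complete (in the additive uniformity), convex and bounded subset of a locally convex space. -/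

import Mathlib

open Filter Topology
open scoped BoundedContinuousFunction

universe u v

/-- `f` is right uniformly continuous: for every `ε > 0` there is a neighbourhood `V` of the
identity such that `|f x - f y| < ε` whenever `x * y⁻¹ ∈ V`. -/
def IsRightUniformlyContinuous {G : Type u} [Group G] [TopologicalSpace G] (f : G → ℝ) : Prop :=
  ∀ ε > 0, ∃ V ∈ 𝓝 (1 : G), ∀ x y : G, x * y⁻¹ ∈ V → |f x - f y| < ε

/-- The space of bounded right uniformly continuous real-valued functions on `G`. -/
def RUCB (G : Type u) [Group G] [TopologicalSpace G] : Submodule ℝ (G →ᵇ ℝ) where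
  carrier := {f | IsRightUniformlyContinuous (f : G → ℝ)}
  zero_mem' := fun ε hε => ⟨Set.univ, univ_mem, fun x y _ => by simpa using hε⟩
  add_mem' := by
    intro f f' hf hf' ε hε
    obtain ⟨V, hV, h⟩ := hf (ε / 2) (half_pos hε)
    obtain ⟨V', hV', h'⟩ := hf' (ε / 2) (half_pos hε)
    refine ⟨V ∩ V', inter_mem hV hV', fun x y hxy => ?_⟩
    have h1 := abs_lt.1 (h x y hxy.1)
    have h2 := abs_lt.1 (h' x y hxy.2)
    simp only [BoundedContinuousFunction.coe_add, Pi.add_apply]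
    rw [abs_lt]
    constructor <;> linarith [h1.1, h1.2, h2.1, h2.2]
  smul_mem' := by
    intro c f hf ε hε
    have hc : 0 < |c| + 1 := by positivity
    obtain ⟨V, hV, h⟩ := hf (ε / (|c| + 1)) (div_pos hε hc)
    refine ⟨V, hV, fun x y hxy => ?_⟩
    have h1 := (lt_div_iff₀ hc).1 (h x y hxy)
    simp only [BoundedContinuousFunction.coe_smul, smul_eq_mul]
    rw [← mul_sub, abs_mul]
    nlinarith [abs_nonneg c, abs_nonneg (f x - f y)]

/-- The constant function `1` as an element of `RUCB G`. -/
def RUCB.one (G : Type u) [Group G] [TopologicalSpace G] : RUCB G :=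
  ⟨1, fun ε hε => ⟨Set.univ, univ_mem, fun x y _ => by simpa using hε⟩⟩

/-- The left translate of `f` by `g`, that is, the function `x ↦ f (g⁻¹ * x)`. -/
def RUCB.translate {G : Type u} [Group G] [TopologicalSpace G] [IsTopologicalGroup G]
    (g : G) (f : RUCB G) : RUCB G :=
  ⟨(f : G →ᵇ ℝ).compContinuous ⟨fun x => g⁻¹ * x, continuous_const_mul g⁻¹⟩, by
    intro ε hε
    obtain ⟨V, hV, h⟩ := f.2 ε hε
    have hc : Tendsto (fun z : G => g⁻¹ * z * g) (𝓝 1) (𝓝 1) := by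
      have : Continuous fun z : G => g⁻¹ * z * g := by fun_prop
      simpa using this.tendsto 1
    refine ⟨_, hc hV, fun x y hxy => h (g⁻¹ * x) (g⁻¹ * y) ?_⟩
    simpa [mul_assoc] using hxy⟩

/-- `G` is amenable: there is a left-invariant mean on `RUCB G`, that is, a positive linear
functional taking the value `1` at the constant function `1` and invariant under left
translations. -/
def IsAmenable (G : Type u) [Group G] [TopologicalSpace G] [IsTopologicalGroup G] : Prop :=
  ∃ m : RUCB G →ₗ[ℝ] ℝ,
    (∀ f : RUCB G, (∀ x : G, 0 ≤ (f : G →ᵇ ℝ) x) → 0 ≤ m f) ∧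
    m (RUCB.one G) = 1 ∧
    ∀ (g : G) (f : RUCB G), m (RUCB.translate g f) = m f

/-- The action of `G` on the subset `C` of a vector space is by affine maps: every `g` preserves
the convex combinations that lie in `C`. -/
def IsAffineAction (G : Type u) [Group G] {X : Type v} [AddCommGroup X] [Module ℝ X]
    (C : Set X) [MulAction G C] : Prop :=
  ∀ (g : G) (x y z : C) (a b : ℝ), 0 ≤ a → 0 ≤ b → a + b = 1 →
    (z : X) = a • (x : X) + b • (y : X) →
      ((g • z : C) : X) = a • ((g • x : C) : X) + b • ((g • y : C) : X)

/-- `G` has the approximate fixed point property on `C`: every (jointly) continuous affine action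
of `G` on `C` admits a net `x` in `C`, indexed by a nonempty directed set, such that
`x i - g • x i` converges to `0` for every `g`. -/
def HasAFPProperty (G : Type u) [Group G] [TopologicalSpace G] {X : Type v} [AddCommGroup X]
    [Module ℝ X] [TopologicalSpace X] (C : Set X) : Prop :=
  ∀ [MulAction G C] [ContinuousSMul G C], IsAffineAction G C →
    ∃ (ι : Type (max u v)) (_ : Preorder ι) (_ : IsDirectedOrder ι) (_ : Nonempty ι) (x : ι → C),
      ∀ g : G, Tendsto (fun i => (x i : X) - ((g • x i : C) : X)) atTop (𝓝 0)

/-! Orbit functions `h ↦ l (h • x)` on a bounded set are bounded and continuous, but need not be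
right uniformly continuous, so a mean on `RUCB G` cannot be applied to them directly. Local
compactness repairs this: smoothing by a fixed normalised `ψ` in `C_c(G, ℝ)` sends bounded
continuous functions into `RUCB G`, and `f ↦ m (ψ * f)` is still left invariant by uniqueness of
Haar measure (`RUCB.map_conv_leftTranslate_of_nonneg`). Given such a mean, a Hahn–Banach separation
in a finite power of `X` gives almost fixed points (`exists_almost_fixed_of_mean`).

Conversely, the means on `RUCB G` form a compact convex set on which `G` acts continuously and
affinely. A cluster point of an approximately fixed net there is an invariant mean. -/

open MeasureTheory
open scoped CompactlySupported

/-! ### Convolution with compactly supported functions, and Haar uniqueness. -/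

section Convolution

variable {G : Type u} [Group G] [TopologicalSpace G]

theorem RUCB.ext_apply {f f' : RUCB G} (h : ∀ x, (f : G →ᵇ ℝ) x = (f' : G →ᵇ ℝ) x) : f = f' :=
  Subtype.ext (BoundedContinuousFunction.ext h)

theorem abs_integral_mul_le [MeasurableSpace G] [BorelSpace G] (μ : Measure G)
    [IsFiniteMeasureOnCompacts μ] (φ : C_c(G, ℝ)) (f : G →ᵇ ℝ) (x : G) :
    |∫ y, φ y * f (y⁻¹ * x) ∂μ| ≤ (∫ y, |φ y| ∂μ) * ‖f‖ := by
  rw [← integral_mul_const ‖f‖ fun y => |φ y|]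
  have hφ : Integrable φ μ := φ.continuous.integrable_of_hasCompactSupport φ.hasCompactSupport
  change ‖∫ y, φ y * f (y⁻¹ * x) ∂μ‖ ≤ _
  refine norm_integral_le_of_norm_le (hφ.abs.mul_const _) ?_
  filter_upwards with y
  rw [Real.norm_eq_abs, abs_mul]
  exact mul_le_mul_of_nonneg_left (f.norm_coe_le_norm _) (abs_nonneg _)

variable [IsTopologicalGroup G]

theorem IsRightUniformlyContinuous.continuous {f : G → ℝ} (hf : IsRightUniformlyContinuous f) :
    Continuous f := by
  rw [continuous_iff_continuousAt]
  intro x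
  rw [ContinuousAt, Metric.tendsto_nhds]
  intro ε hε
  obtain ⟨V, hV, h⟩ := hf ε hε
  have hc : Tendsto (fun y : G => y * x⁻¹) (𝓝 x) (𝓝 1) := by
    have : Continuous fun y : G => y * x⁻¹ := by fun_prop
    simpa using this.tendsto x
  filter_upwards [hc hV] with y hy
  exact h y x hy

/-- The left translate `x ↦ f (g⁻¹ * x)` of a bounded continuous function. -/
noncomputable def BoundedContinuousFunction.leftTranslate (g : G) (f : G →ᵇ ℝ) : G →ᵇ ℝ :=
  f.compContinuous ⟨fun x => g⁻¹ * x, continuous_const_mul g⁻¹⟩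

@[simp]
theorem BoundedContinuousFunction.leftTranslate_apply (g : G) (f : G →ᵇ ℝ) (x : G) :
    f.leftTranslate g x = f (g⁻¹ * x) := rfl

@[simp]
theorem RUCB.translate_apply (g : G) (f : RUCB G) (x : G) :
    (RUCB.translate g f : G →ᵇ ℝ) x = (f : G →ᵇ ℝ) (g⁻¹ * x) := rfl

/-- The left translate `x ↦ φ (g⁻¹ * x)` of a compactly supported continuous function. -/
def CompactlySupportedContinuousMap.leftTranslate (g : G) (φ : C_c(G, ℝ)) : C_c(G, ℝ) where
  toFun x := φ (g⁻¹ * x)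
  continuous_toFun := φ.continuous.comp (continuous_const_mul g⁻¹)
  hasCompactSupport' := φ.hasCompactSupport.comp_homeomorph (Homeomorph.mulLeft g⁻¹)

/-- The right translate `x ↦ φ (x * g)` of a compactly supported continuous function. -/
def CompactlySupportedContinuousMap.rightTranslate (g : G) (φ : C_c(G, ℝ)) : C_c(G, ℝ) where
  toFun x := φ (x * g)
  continuous_toFun := φ.continuous.comp (continuous_mul_const g)
  hasCompactSupport' := φ.hasCompactSupport.comp_homeomorph (Homeomorph.mulRight g)

@[simp]
theorem CompactlySupportedContinuousMap.leftTranslate_apply (g : G) (φ : C_c(G, ℝ)) (x : G) :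
    φ.leftTranslate g x = φ (g⁻¹ * x) := rfl

@[simp]
theorem CompactlySupportedContinuousMap.rightTranslate_apply (g : G) (φ : C_c(G, ℝ)) (x : G) :
    φ.rightTranslate g x = φ (x * g) := rfl

variable [MeasurableSpace G] [BorelSpace G]

/-- The convolution of a compactly supported function and a bounded function. -/
noncomputable def convFun (μ : Measure G) (φ : C_c(G, ℝ)) (f : G →ᵇ ℝ) (x : G) : ℝ :=
  ∫ y, φ y * f (y⁻¹ * x) ∂μ

theorem integrable_convFun_integrand (μ : Measure G) [IsFiniteMeasureOnCompacts μ]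
    (φ : C_c(G, ℝ)) (f : G →ᵇ ℝ) (x : G) : Integrable (fun y => φ y * f (y⁻¹ * x)) μ := by
  refine Continuous.integrable_of_hasCompactSupport ?_ φ.hasCompactSupport.mul_right
  have h1 := φ.continuous
  have h2 := f.continuous
  fun_prop

/-- Right translations multiply the Haar integral by a constant. -/
theorem exists_integral_comp_mul_right_eq (μ : Measure G) [μ.IsHaarMeasure] (g : G) :
    ∃ d : ℝ, ∀ f : G → ℝ, Continuous f → HasCompactSupport f →
      ∫ x, f (x * g) ∂μ = d * ∫ x, f x ∂μ := by
  obtain ⟨d, hd⟩ := Measure.exists_integral_isMulLeftInvariant_eq_smul_of_hasCompactSupport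
    (Measure.map (fun x => x * g) μ) μ
  refine ⟨d, fun f hf hf' => ?_⟩
  have := hd f hf hf'
  rw [integral_map (measurable_mul_const g).aemeasurable hf.aestronglyMeasurable,
    integral_smul_nnreal_measure] at this
  exact this

variable [LocallyCompactSpace G]

/-- For `v` in a compact neighbourhood `K` of `1`, all the integrands vanish off the one compact set
`K⁻¹ * tsupport φ ∪ tsupport φ`, so the integral is continuous in `v`. -/
theorem tendsto_integral_abs_leftTranslate_sub (μ : Measure G) [IsFiniteMeasureOnCompacts μ]
    (φ : C_c(G, ℝ)) :
    Tendsto (fun v : G => ∫ y, |φ (v * y) - φ y| ∂μ) (𝓝 1) (𝓝 0) := by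
  obtain ⟨K, hK, hK1⟩ := exists_compact_mem_nhds (1 : G)
  have hS : IsCompact (tsupport φ) := φ.hasCompactSupport
  have hc : ContinuousOn (fun v : G => ∫ y, |φ (v * y) - φ y| ∂μ) K := by
    apply continuousOn_integral_of_compact_support ((hK.inv.mul hS).union hS)
    · have h1 := φ.continuous
      apply Continuous.continuousOn
      simp only [Function.uncurry_def]
      fun_prop
    · intro v y hv hy
      simp only [Set.mem_union, not_or] at hy
      have h1 : φ (v * y) = 0 := by
        by_contra h
        exact hy.1 ⟨v⁻¹, by simpa using hv, v * y, subset_tsupport _ h, by simp⟩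
      have h2 : φ y = 0 := image_eq_zero_of_notMem_tsupport hy.2
      simp [h1, h2]
  have := (hc.continuousAt hK1).tendsto
  simpa using this

/-- Left invariance of `μ` moves a translation by `v` from `f` onto `φ`; the change is then at most
the `L¹` distance from `φ` to its translate times `‖f‖`, uniformly in the point. -/
theorem isRightUniformlyContinuous_convFun (μ : Measure G) [IsFiniteMeasureOnCompacts μ]
    [μ.IsMulLeftInvariant] (φ : C_c(G, ℝ)) (f : G →ᵇ ℝ) :
    IsRightUniformlyContinuous (convFun μ φ f) := by
  intro ε hε
  have ht : Tendsto (fun v : G => (∫ y, |φ (v * y) - φ y| ∂μ) * ‖f‖) (𝓝 1) (𝓝 0) := by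
    simpa using (tendsto_integral_abs_leftTranslate_sub μ φ).mul_const ‖f‖
  refine ⟨_, ht.eventually_lt_const hε, fun x y hxy => lt_of_le_of_lt ?_ hxy⟩
  obtain ⟨v, rfl⟩ : ∃ v, x = v * y := ⟨x * y⁻¹, by simp⟩
  have h1 : convFun μ φ f (v * y) = ∫ z, φ.leftTranslate v⁻¹ z * f (z⁻¹ * y) ∂μ := by
    rw [convFun, ← integral_mul_left_eq_self _ v]
    simp [mul_assoc]
  have h2 := abs_integral_mul_le μ (φ.leftTranslate v⁻¹ - φ) f y
  simp only [CompactlySupportedContinuousMap.coe_sub, Pi.sub_apply, sub_mul] at h2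
  rw [integral_sub (integrable_convFun_integrand μ _ f y) (integrable_convFun_integrand μ _ f y),
    ← h1] at h2
  simpa [convFun] using h2

/-- The convolution of a compactly supported continuous function and a bounded continuous function,
as a bounded right uniformly continuous function. -/
noncomputable def RUCB.conv (μ : Measure G) [IsFiniteMeasureOnCompacts μ]
    [μ.IsMulLeftInvariant] (φ : C_c(G, ℝ)) (f : G →ᵇ ℝ) : RUCB G :=
  ⟨BoundedContinuousFunction.ofNormedAddCommGroup (convFun μ φ f)
    (isRightUniformlyContinuous_convFun μ φ f).continuous _ (abs_integral_mul_le μ φ f),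
    isRightUniformlyContinuous_convFun μ φ f⟩

variable (μ : Measure G) [IsFiniteMeasureOnCompacts μ] [μ.IsMulLeftInvariant]

@[simp]
theorem RUCB.conv_apply (φ : C_c(G, ℝ)) (f : G →ᵇ ℝ) (x : G) :
    (RUCB.conv μ φ f : G →ᵇ ℝ) x = ∫ y, φ y * f (y⁻¹ * x) ∂μ := rfl

/-- Convolution is linear in the compactly supported function. -/
noncomputable def RUCB.convLeft (f : G →ᵇ ℝ) : C_c(G, ℝ) →ₗ[ℝ] RUCB G where
  toFun φ := RUCB.conv μ φ f
  map_add' φ ψ := RUCB.ext_apply fun x => by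
    have := integral_add (integrable_convFun_integrand μ φ f x)
      (integrable_convFun_integrand μ ψ f x)
    simpa [add_mul] using this
  map_smul' c φ := RUCB.ext_apply fun x => by
    simp [mul_assoc, integral_const_mul]

/-- Convolution is linear in the bounded function. -/
noncomputable def RUCB.convRight (φ : C_c(G, ℝ)) : (G →ᵇ ℝ) →ₗ[ℝ] RUCB G where
  toFun f := RUCB.conv μ φ f
  map_add' f f' := RUCB.ext_apply fun x => by
    have := integral_add (integrable_convFun_integrand μ φ f x)
      (integrable_convFun_integrand μ φ f' x)
    simpa [mul_add] using this
  map_smul' c f := RUCB.ext_apply fun x => by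
    simp [mul_left_comm, integral_const_mul]

theorem RUCB.conv_nonneg {φ : C_c(G, ℝ)} {f : G →ᵇ ℝ} (hφ : ∀ x, 0 ≤ φ x) (hf : ∀ x, 0 ≤ f x)
    (x : G) : 0 ≤ (RUCB.conv μ φ f : G →ᵇ ℝ) x :=
  integral_nonneg fun y => mul_nonneg (hφ y) (hf _)

theorem RUCB.conv_leftTranslate_left (g : G) (φ : C_c(G, ℝ)) (f : G →ᵇ ℝ) :
    RUCB.conv μ (φ.leftTranslate g) f = RUCB.translate g (RUCB.conv μ φ f) := by
  refine RUCB.ext_apply fun x => ?_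
  rw [RUCB.translate_apply, RUCB.conv_apply, RUCB.conv_apply, ← integral_mul_left_eq_self _ g]
  simp [mul_assoc]

variable [T2Space G]

/-- A positive linear functional on `C_c(G, ℝ)` that is invariant under left translations is a
multiple of the integral against Haar measure. -/
theorem PositiveLinearMap.eq_const_mul_integral_of_leftInvariant (μ : Measure G) [μ.IsHaarMeasure]
    (Λ : C_c(G, ℝ) →ₚ[ℝ] ℝ) (hΛ : ∀ g φ, Λ (φ.leftTranslate g) = Λ φ) :
    ∃ c : ℝ, ∀ φ, Λ φ = c * ∫ x, φ x ∂μ := by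
  have hinv : (RealRMK.rieszMeasure Λ).IsMulLeftInvariant := by
    refine ⟨fun g => ?_⟩
    have : (Measure.map (fun x => g * x) (RealRMK.rieszMeasure Λ)).Regular :=
      Measure.Regular.map (Homeomorph.mulLeft g)
    refine Measure.ext_of_integral_eq_on_compactlySupported fun φ => ?_
    rw [integral_map (f := φ) (measurable_const_mul g).aemeasurable
      φ.continuous.aestronglyMeasurable]
    have := RealRMK.integral_rieszMeasure Λ (φ.leftTranslate g⁻¹)
    rw [hΛ, ← RealRMK.integral_rieszMeasure] at this
    simpa using this
  obtain ⟨c, hc⟩ := Measure.exists_integral_isMulLeftInvariant_eq_smul_of_hasCompactSupport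
    (RealRMK.rieszMeasure Λ) μ
  refine ⟨c, fun φ => ?_⟩
  rw [← RealRMK.integral_rieszMeasure, hc φ φ.continuous φ.hasCompactSupport,
    integral_smul_nnreal_measure]
  rfl

/-- For fixed `f ≥ 0`, the functional `φ ↦ m (φ * f)` is positive and left invariant, hence a
multiple of the Haar integral. Translating `f` amounts to right translating `φ` and scaling by the
modular constant `d`, and the Haar integral of `φ` absorbs both. -/
theorem RUCB.map_conv_leftTranslate_of_nonneg (μ : Measure G) [μ.IsHaarMeasure]
    {m : RUCB G →ₗ[ℝ] ℝ} (hm : ∀ f : RUCB G, (∀ x : G, 0 ≤ (f : G →ᵇ ℝ) x) → 0 ≤ m f)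
    (hinv : ∀ (g : G) (f : RUCB G), m (RUCB.translate g f) = m f) (φ : C_c(G, ℝ)) {f : G →ᵇ ℝ}
    (hf : ∀ x, 0 ≤ f x) (g : G) :
    m (RUCB.conv μ φ (f.leftTranslate g)) = m (RUCB.conv μ φ f) := by
  obtain ⟨c, hc⟩ := PositiveLinearMap.eq_const_mul_integral_of_leftInvariant μ
    (PositiveLinearMap.mk₀ (m ∘ₗ RUCB.convLeft μ f)
      fun φ hφ => hm _ (RUCB.conv_nonneg μ hφ hf))
    (fun g φ => by
      change m (RUCB.conv μ _ f) = m (RUCB.conv μ φ f)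
      rw [RUCB.conv_leftTranslate_left, hinv])
  replace hc : ∀ φ, m (RUCB.conv μ φ f) = c * ∫ x, φ x ∂μ := hc
  obtain ⟨d, hd⟩ := exists_integral_comp_mul_right_eq μ g
  have hconv : RUCB.conv μ φ (f.leftTranslate g) = d • RUCB.conv μ (φ.rightTranslate g⁻¹) f := by
    refine RUCB.ext_apply fun x => ?_
    have := hd (fun y => φ.rightTranslate g⁻¹ y * f (y⁻¹ * x)) (by
      have h1 := (φ.rightTranslate g⁻¹).continuous
      have h2 := f.continuous
      fun_prop) (φ.rightTranslate g⁻¹).hasCompactSupport.mul_right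
    simpa [mul_assoc] using this
  have hint := hd (φ.rightTranslate g⁻¹) (φ.rightTranslate g⁻¹).continuous
    (φ.rightTranslate g⁻¹).hasCompactSupport
  simp only [CompactlySupportedContinuousMap.rightTranslate_apply, mul_inv_cancel_right] at hint
  rw [hconv, map_smul, hc, hc, hint, smul_eq_mul]
  simp only [CompactlySupportedContinuousMap.rightTranslate_apply]
  ring

end Convolution

/-! ### Extending the mean to all bounded continuous functions. -/

/-- An amenable locally compact group has a left-invariant mean on all bounded continuous
functions. -/
theorem IsAmenable.exists_mean_boundedContinuousFunction {G : Type u} [Group G]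
    [TopologicalSpace G] [IsTopologicalGroup G] [T2Space G] [LocallyCompactSpace G]
    (hG : IsAmenable G) :
    ∃ M : (G →ᵇ ℝ) →ₗ[ℝ] ℝ, (∀ f : G →ᵇ ℝ, (∀ x, 0 ≤ f x) → 0 ≤ M f) ∧ M 1 = 1 ∧
      ∀ (g : G) (f : G →ᵇ ℝ), M (f.leftTranslate g) = M f := by
  obtain ⟨m, hm, hm1, hinv⟩ := hG
  borelize G
  let μ : Measure G := Measure.haar
  obtain ⟨⟨φ, φc⟩, φs, φ0, φ1⟩ :
    ∃ φ : C(G, ℝ), HasCompactSupport φ ∧ 0 ≤ φ ∧ φ 1 ≠ 0 := exists_continuous_nonneg_pos 1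
  have hpos : 0 < ∫ x, φ x ∂μ := φc.integral_pos_of_hasCompactSupport_nonneg_nonzero φs φ0 φ1
  let ψ : C_c(G, ℝ) := (∫ x, φ x ∂μ)⁻¹ • ⟨⟨φ, φc⟩, φs⟩
  have hψ0 : ∀ x, 0 ≤ ψ x := fun x => mul_nonneg (inv_nonneg.2 hpos.le) (φ0 x)
  have hψ1 : ∫ x, ψ x ∂μ = 1 := by
    change ∫ x, (∫ x, φ x ∂μ)⁻¹ * φ x ∂μ = 1
    rw [integral_const_mul, inv_mul_cancel₀ hpos.ne']
  have hone : RUCB.convRight μ ψ 1 = RUCB.one G := RUCB.ext_apply fun x => by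
    change ∫ y, ψ y * 1 ∂μ = 1
    simpa using hψ1
  refine ⟨m ∘ₗ RUCB.convRight μ ψ, fun f hf => hm _ (RUCB.conv_nonneg μ hψ0 hf), ?_, ?_⟩
  · rw [LinearMap.comp_apply, hone, hm1]
  · intro g f
    -- Adding the constant `‖f‖` makes `f` nonnegative, and constants are fixed by translation.
    have key := RUCB.map_conv_leftTranslate_of_nonneg μ hm hinv ψ (f := f + ‖f‖ • 1) (fun x => by
      have := neg_le_of_abs_le (f.norm_coe_le_norm x)
      simp only [BoundedContinuousFunction.coe_add, Pi.add_apply,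
        BoundedContinuousFunction.coe_smul, BoundedContinuousFunction.coe_one, Pi.one_apply,
        smul_eq_mul]
      linarith) g
    have h1 : (f + ‖f‖ • 1).leftTranslate g = f.leftTranslate g + ‖f‖ • 1 := by
      ext x; simp
    change m (RUCB.convRight μ ψ _) = m (RUCB.convRight μ ψ _) at key
    rw [h1, map_add, map_add, map_add, map_add] at key
    exact add_right_cancel key

/-! ### From an invariant mean to almost fixed points. -/

/-- The evaluation of a continuous linear functional along an orbit in a bounded set. -/
noncomputable def orbitFunction {G : Type u} [Group G] [TopologicalSpace G] {X : Type v}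
    [AddCommGroup X] [Module ℝ X] [TopologicalSpace X] {C : Set X}
    (hC : Bornology.IsVonNBounded ℝ C) [MulAction G C] [ContinuousSMul G C] (l : X →L[ℝ] ℝ)
    (x : C) : G →ᵇ ℝ :=
  BoundedContinuousFunction.mkOfBound
    ⟨fun h => l (h • x : C), l.continuous.comp (by fun_prop)⟩
    (Metric.isBounded_iff.1 ((NormedSpace.isVonNBounded_iff ℝ).1 (hC.image l))).choose
    fun g h => (Metric.isBounded_iff.1 ((NormedSpace.isVonNBounded_iff ℝ).1
      (hC.image l))).choose_spec ⟨_, (g • x).2, rfl⟩ ⟨_, (h • x).2, rfl⟩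

/-- If there is a left-invariant mean on the bounded continuous functions, then affine actions on
bounded convex sets have points almost fixed by any given finite set of group elements. -/
theorem exists_almost_fixed_of_mean {G : Type u} [Group G] [TopologicalSpace G]
    [IsTopologicalGroup G] {M : (G →ᵇ ℝ) →ₗ[ℝ] ℝ}
    (hM : ∀ f : G →ᵇ ℝ, (∀ x, 0 ≤ f x) → 0 ≤ M f) (hM1 : M 1 = 1)
    (hinv : ∀ (g : G) (f : G →ᵇ ℝ), M (f.leftTranslate g) = M f)
    {X : Type v} [AddCommGroup X] [Module ℝ X] [TopologicalSpace X] [IsTopologicalAddGroup X]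
    [ContinuousSMul ℝ X] [LocallyConvexSpace ℝ X] {C : Set X} (hne : C.Nonempty)
    (hconv : Convex ℝ C) (hC : Bornology.IsVonNBounded ℝ C) [MulAction G C] [ContinuousSMul G C]
    (haff : IsAffineAction G C) (s : Finset G) {U : Set X} (hU : U ∈ 𝓝 0) :
    ∃ x : C, ∀ g ∈ s, (x : X) - (g • x : C) ∈ U := by
  classical
  let T : C → (s → X) := fun x g => (x : X) - ((g : G) • x : C)
  suffices h0 : (0 : s → X) ∈ closure (Set.range T) by
    have hV : Set.univ.pi (fun _ : s => U) ∈ 𝓝 (0 : s → X) :=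
      set_pi_mem_nhds Set.finite_univ fun _ _ => hU
    obtain ⟨_, hy, x, rfl⟩ := mem_closure_iff_nhds.1 h0 _ hV
    exact ⟨x, fun g hg => hy ⟨g, hg⟩ trivial⟩
  by_contra h0
  have hT : Convex ℝ (Set.range T) := by
    rintro _ ⟨x, rfl⟩ _ ⟨y, rfl⟩ a b ha hb hab
    refine ⟨⟨a • (x : X) + b • (y : X), hconv x.2 y.2 ha hb hab⟩, funext fun g => ?_⟩
    have := haff g x y ⟨a • (x : X) + b • (y : X), hconv x.2 y.2 ha hb hab⟩ a b ha hb hab rfl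
    simp only [T, Pi.add_apply, Pi.smul_apply, this, smul_sub]
    abel
  -- Here `0 < c < L (T x)` for every `x`. Along the orbit of `x₀`, `L ∘ T` is the sum `F` of
  -- differences between functions and their translates, so `M F = 0`, whereas `F > c` forces `M F ≥
  -- c`.
  obtain ⟨L, c, hc0, hc⟩ := geometric_hahn_banach_point_closed hT.closure isClosed_closure h0
  rw [map_zero] at hc0
  obtain ⟨x₀, hx₀⟩ := hne
  let f : s → (G →ᵇ ℝ) := fun g =>
    orbitFunction hC (L ∘L ContinuousLinearMap.single ℝ (fun _ : s => X) g) ⟨x₀, hx₀⟩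
  let F : G →ᵇ ℝ := ∑ g : s, (f g - (f g).leftTranslate (g : G)⁻¹)
  have hF0 : M F = 0 := by
    simp [F, hinv]
  have hFc : ∀ h, c < F h := by
    intro h
    refine lt_of_lt_of_eq (hc _ (subset_closure ⟨h • ⟨x₀, hx₀⟩, rfl⟩)) ?_
    have : T (h • ⟨x₀, hx₀⟩) = ∑ g : s, Pi.single g (T (h • ⟨x₀, hx₀⟩) g) :=
      (Finset.univ_sum_single _).symm
    rw [this, map_sum]
    simp only [F, BoundedContinuousFunction.coe_sum, Finset.sum_apply,
      BoundedContinuousFunction.coe_sub, Pi.sub_apply,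
      BoundedContinuousFunction.leftTranslate_apply, inv_inv]
    refine Finset.sum_congr rfl fun g _ => ?_
    simp only [T, Pi.single_sub, map_sub, smul_smul]
    rfl
  have := hM (F - c • 1) fun h => by
    simpa using (hFc h).le
  rw [map_sub, map_smul, hM1, hF0, smul_eq_mul] at this
  linarith

/-- An amenable locally compact group has the approximate fixed point property on bounded convex
sets. -/
theorem IsAmenable.hasAFPProperty {G : Type u} [Group G] [TopologicalSpace G]
    [IsTopologicalGroup G] [T2Space G] [LocallyCompactSpace G] (hG : IsAmenable G)
    {X : Type (max u v)} [AddCommGroup X] [Module ℝ X] [TopologicalSpace X]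
    [IsTopologicalAddGroup X] [ContinuousSMul ℝ X] [LocallyConvexSpace ℝ X] {C : Set X}
    (hne : C.Nonempty) (hconv : Convex ℝ C) (hC : Bornology.IsVonNBounded ℝ C) :
    HasAFPProperty G C := by
  classical
  intro _ _ haff
  obtain ⟨M, hM, hM1, hinv⟩ := hG.exists_mean_boundedContinuousFunction
  -- The net is indexed by finite subsets of `G` and neighbourhoods of `0` under reverse inclusion.
  choose x hx using fun i : Finset G × {U : Set X // U ∈ 𝓝 (0 : X)}ᵒᵈ =>
    exists_almost_fixed_of_mean hM hM1 hinv hne hconv hC haff i.1 (OrderDual.ofDual i.2).2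
  have : IsDirectedOrder (Finset G × {U : Set X // U ∈ 𝓝 (0 : X)}ᵒᵈ) :=
    ⟨fun i j => ⟨(i.1 ∪ j.1,
      OrderDual.toDual ⟨(OrderDual.ofDual i.2).1 ∩ (OrderDual.ofDual j.2).1,
      inter_mem (OrderDual.ofDual i.2).2 (OrderDual.ofDual j.2).2⟩),
      ⟨Finset.subset_union_left, Set.inter_subset_left⟩,
      ⟨Finset.subset_union_right, Set.inter_subset_right⟩⟩⟩
  have : Nonempty {U : Set X // U ∈ 𝓝 (0 : X)}ᵒᵈ := ⟨OrderDual.toDual ⟨Set.univ, univ_mem⟩⟩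
  refine ⟨Finset G × {U : Set X // U ∈ 𝓝 (0 : X)}ᵒᵈ, inferInstance, inferInstance, inferInstance,
    x, fun g U hU => ?_⟩
  rw [mem_map]
  filter_upwards [eventually_ge_atTop (({g}, OrderDual.toDual ⟨U, hU⟩) :
    Finset G × {U : Set X // U ∈ 𝓝 (0 : X)}ᵒᵈ)] with i hi
  exact (show (OrderDual.ofDual i.2).1 ⊆ U from hi.2) (hx i g (hi.1 (Finset.mem_singleton_self g)))

/-! ### The compact convex `G`-space of means. -/

section Means

variable {G : Type u} [Group G] [TopologicalSpace G]

/-- The set of means on `RUCB G`, inside the space of all functions with the topology of pointwise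
convergence. -/
def meanSet (G : Type u) [Group G] [TopologicalSpace G] : Set (ULift.{v} (RUCB G) → ℝ) :=
  {φ | (∀ f f' : RUCB G, φ ⟨f + f'⟩ = φ ⟨f⟩ + φ ⟨f'⟩) ∧
    (∀ (c : ℝ) (f : RUCB G), φ ⟨c • f⟩ = c * φ ⟨f⟩) ∧
    (∀ f : RUCB G, (∀ x, 0 ≤ (f : G →ᵇ ℝ) x) → 0 ≤ φ ⟨f⟩) ∧ φ ⟨RUCB.one G⟩ = 1}

theorem meanSet_nonempty : (meanSet.{u, v} G).Nonempty :=
  ⟨fun f => (f.down : G →ᵇ ℝ) 1, fun _ _ => rfl, fun _ _ => rfl, fun _ h => h 1, rfl⟩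

theorem convex_meanSet : Convex ℝ (meanSet.{u, v} G) := by
  rintro φ ⟨h1, h2, h3, h4⟩ ψ ⟨h1', h2', h3', h4'⟩ a b ha hb hab
  refine ⟨fun f f' => ?_, fun c f => ?_, fun f hf => ?_, ?_⟩ <;>
    simp only [Pi.add_apply, Pi.smul_apply, smul_eq_mul]
  · rw [h1, h1']; ring
  · rw [h2, h2']; ring
  · have := h3 f hf
    have := h3' f hf
    positivity
  · rw [h4, h4']; linarith

theorem isClosed_meanSet : IsClosed (meanSet.{u, v} G) := by
  simp only [meanSet, Set.ofPred_and, Set.ofPred_forall]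
  refine IsClosed.inter ?_ (IsClosed.inter ?_ (IsClosed.inter ?_ ?_))
  · exact isClosed_iInter fun f => isClosed_iInter fun f' =>
      isClosed_eq (by fun_prop) (by fun_prop)
  · exact isClosed_iInter fun c => isClosed_iInter fun f =>
      isClosed_eq (by fun_prop) (by fun_prop)
  · exact isClosed_iInter fun f => isClosed_iInter fun _ =>
      isClosed_le (by fun_prop) (by fun_prop)
  · exact isClosed_eq (by fun_prop) (by fun_prop)

theorem sub_eq_of_mem_meanSet {φ : ULift.{v} (RUCB G) → ℝ} (hφ : φ ∈ meanSet.{u, v} G)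
    (f f' : RUCB G) : φ ⟨f - f'⟩ = φ ⟨f⟩ - φ ⟨f'⟩ := by
  have h : f - f' + f' = f := RUCB.ext_apply fun x => by simp
  rw [eq_sub_iff_add_eq, ← hφ.1, h]

theorem abs_le_of_mem_meanSet {φ : ULift.{v} (RUCB G) → ℝ} (hφ : φ ∈ meanSet.{u, v} G)
    {f : RUCB G} {c : ℝ} (hf : ∀ x, |(f : G →ᵇ ℝ) x| ≤ c) : |φ ⟨f⟩| ≤ c := by
  have hc : φ ⟨c • RUCB.one G⟩ = c := by rw [hφ.2.1, hφ.2.2.2, mul_one]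
  have h1 := hφ.2.2.1 (c • RUCB.one G - f) fun x => by
    change 0 ≤ c * 1 - (f : G →ᵇ ℝ) x
    linarith [le_of_abs_le (hf x)]
  have h2 := hφ.2.2.1 (c • RUCB.one G + f) fun x => by
    change 0 ≤ c * 1 + (f : G →ᵇ ℝ) x
    linarith [neg_le_of_abs_le (hf x)]
  rw [sub_eq_of_mem_meanSet hφ] at h1
  rw [hφ.1] at h2
  exact abs_le.2 ⟨by linarith, by linarith⟩

theorem isCompact_meanSet : IsCompact (meanSet.{u, v} G) := by
  refine IsCompact.of_isClosed_subset
    (isCompact_univ_pi fun f : ULift.{v} (RUCB G) =>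
      isCompact_Icc (a := -‖(f.down : G →ᵇ ℝ)‖) (b := ‖(f.down : G →ᵇ ℝ)‖))
    isClosed_meanSet fun φ hφ f _ => abs_le.1 (abs_le_of_mem_meanSet hφ fun x => ?_)
  exact (f.down : G →ᵇ ℝ).norm_coe_le_norm x

variable [IsTopologicalGroup G]

/-- The action of `G` on the means of `RUCB G` that is dual to left translation. -/
instance : MulAction G (meanSet.{u, v} G) where
  smul g φ := ⟨fun f => φ.1 ⟨RUCB.translate g⁻¹ f.down⟩, fun f f' =>
    φ.2.1 (RUCB.translate g⁻¹ f) (RUCB.translate g⁻¹ f'),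
    fun c f => φ.2.2.1 c (RUCB.translate g⁻¹ f), fun f hf => φ.2.2.2.1 _ fun x => hf _, φ.2.2.2.2⟩
  one_smul φ := Subtype.ext <| funext fun f => congrArg φ.1 <| ULift.ext _ _ <|
    RUCB.ext_apply fun x => by simp
  mul_smul g h φ := Subtype.ext <| funext fun f => congrArg φ.1 <| ULift.ext _ _ <|
    RUCB.ext_apply fun x => by simp [mul_assoc]

theorem meanSet_smul_apply (g : G) (φ : meanSet.{u, v} G) (f : RUCB G) :
    (g • φ).1 ⟨f⟩ = φ.1 ⟨RUCB.translate g⁻¹ f⟩ := rfl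

/-- Right uniform continuity is exactly what joint continuity needs: if `g' * g⁻¹ ∈ V`, the
translates of `f` by `g'⁻¹` and `g⁻¹` are uniformly close, so every mean nearly agrees on them. The
rest is pointwise convergence of means. -/
instance : ContinuousSMul G (meanSet.{u, v} G) := by
  refine ⟨Continuous.subtype_mk (continuous_pi ?_) _⟩
  rintro ⟨f⟩
  rw [continuous_iff_continuousAt]
  rintro ⟨g, φ⟩
  rw [ContinuousAt, Metric.tendsto_nhds]
  intro ε hε
  obtain ⟨V, hV, h⟩ := f.2 (ε / 2) (half_pos hε)
  have h1 : ∀ᶠ p : G × meanSet.{u, v} G in 𝓝 (g, φ), p.1 * g⁻¹ ∈ V := by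
    have hc : Continuous fun p : G × meanSet.{u, v} G => p.1 * g⁻¹ := by fun_prop
    exact hc.tendsto (g, φ) (by simpa using hV)
  have h2 : ∀ᶠ p : G × meanSet.{u, v} G in 𝓝 (g, φ),
      dist (p.2.1 ⟨RUCB.translate g⁻¹ f⟩) (φ.1 ⟨RUCB.translate g⁻¹ f⟩) < ε / 2 := by
    have hc : Continuous fun p : G × meanSet.{u, v} G => p.2.1 ⟨RUCB.translate g⁻¹ f⟩ :=
      (continuous_apply _).comp (continuous_subtype_val.comp continuous_snd)
    exact (Metric.tendsto_nhds.1 (hc.tendsto (g, φ))) _ (half_pos hε)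
  filter_upwards [h1, h2] with ⟨g', ψ⟩ h1 h2
  change dist (ψ.1 ⟨RUCB.translate g'⁻¹ f⟩) (φ.1 ⟨RUCB.translate g⁻¹ f⟩) < ε
  have h3 : dist (ψ.1 ⟨RUCB.translate g'⁻¹ f⟩) (ψ.1 ⟨RUCB.translate g⁻¹ f⟩) ≤ ε / 2 := by
    rw [Real.dist_eq, ← sub_eq_of_mem_meanSet ψ.2]
    refine abs_le_of_mem_meanSet ψ.2 fun x => ?_
    have := h (g' * x) (g * x) (by simpa [mul_assoc] using h1)
    simpa using this.le
  calc _ ≤ _ := dist_triangle _ (ψ.1 ⟨RUCB.translate g⁻¹ f⟩) _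
    _ < ε / 2 + ε / 2 := add_lt_add_of_le_of_lt h3 h2
    _ = ε := add_halves ε

theorem isAffineAction_meanSet : IsAffineAction G (meanSet.{u, v} G) := by
  intro g φ ψ χ a b _ _ _ h
  exact funext fun f => congrFun h ⟨RUCB.translate g⁻¹ f.down⟩

/-- A group with the approximate fixed point property on its set of means is amenable. -/
theorem IsAmenable.of_hasAFPProperty_meanSet (h : HasAFPProperty G (meanSet.{u, v} G)) :
    IsAmenable G := by
  obtain ⟨ι, _, _, _, x, hx⟩ := h isAffineAction_meanSet
  have : CompactSpace (meanSet.{u, v} G) := isCompact_iff_compactSpace.1 isCompact_meanSet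
  obtain ⟨φ, hφ⟩ := exists_clusterPt_of_compactSpace (map x atTop)
  obtain ⟨l, hl, hlφ⟩ := mapClusterPt_iff_ultrafilter.1 (show MapClusterPt φ atTop x from hφ)
  have hfix : ∀ g : G, (φ : ULift.{v} (RUCB G) → ℝ) = (g • φ : meanSet.{u, v} G) := by
    intro g
    have h1 : Tendsto (fun i => (x i).1 - (g • x i).1) l (𝓝 (φ.1 - (g • φ).1)) :=
      ((continuous_subtype_val.tendsto φ).comp hlφ).sub
        (((continuous_subtype_val.comp (continuous_const_smul g)).tendsto φ).comp hlφ)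
    exact sub_eq_zero.1 (tendsto_nhds_unique h1 ((hx g).mono_left hl))
  refine ⟨⟨⟨fun f => φ.1 ⟨f⟩, φ.2.1⟩, φ.2.2.1⟩, φ.2.2.2.1, φ.2.2.2.2, fun g f => ?_⟩
  have := congrFun (hfix g⁻¹) ⟨f⟩
  rw [meanSet_smul_apply, inv_inv] at this
  exact this.symm

end Means

theorem mainTheorem2 (G : Type u) [Group G] [TopologicalSpace G] [IsTopologicalGroup G]
    [T2Space G] [LocallyCompactSpace G] :
    IsAmenable G ↔
      ∀ (X : Type (max u v)) [AddCommGroup X] [Module ℝ X] [UniformSpace X] [IsUniformAddGroup X]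
        [ContinuousSMul ℝ X] [LocallyConvexSpace ℝ X] [T2Space X] (C : Set X),
        C.Nonempty → IsComplete C → Convex ℝ C → Bornology.IsVonNBounded ℝ C →
          HasAFPProperty G C := by
  refine ⟨fun hG X _ _ _ _ _ _ _ C hne _ hconv hC => ?_, fun h => ?_⟩
  · exact IsAmenable.hasAFPProperty.{u, v} hG hne hconv hC
  · exact IsAmenable.of_hasAFPProperty_meanSet.{u, v} <|
      -- The `ULift` puts the ambient space in `Type (max u v)`, as the quantifier over `X` demands.
      h (ULift.{v} (RUCB G) → ℝ) (meanSet.{u, v} G) meanSet_nonempty isCompact_meanSet.isComplete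
        convex_meanSet (isCompact_meanSet.totallyBounded.isVonNBounded ℝ)
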